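/- All groups are abelian; a group $A$ is called a Whitehead group if $\mathrm{Ext}(A,\mathbb Z)=0$. For an ordinal (or cardinal) $\rho$, a ladder system of length $\rho$ on a set $T$ of ordinals is a family $\{\eta_\delta:\delta\in T\}$ of strictly increasing functions $\eta_\delta:\rho\to\delta$ with range cofinal in $\delta$. Assume GCH. Let $\mu$ be a singular cardinal of cofinality $\sigma$ and let $\lambda=\mu^+$. Let $S$ be a stationary subset of $\lambda$ consisting of ordinals of cofinality $\sigma$, and let $\bar\eta=\{\eta_\delta:\delta\in S\}$ be a ladder system of length $\sigma$ on $S$. If $\sigma>\aleph_0$, let $E$ be a stationary subset of $\sigma$ consisting of limit ordinals of cofinality $\omega$, and let $\bar\zeta=\{\zeta_\nu:\nu\in E\}$ be a ladder system of length $\omega$ on $E$; if $\sigma=\aleph_0$, let $E=\{0\}$. Let $F$ be the free abelian group on the symbols $y_{\delta,\nu,n}$ ($\delta\in S$, $\nu\in E$, $n\in\omega$), $z_{\delta,j}$ ($\delta\in S$, $j<\sigma$) and $x_\beta$ ($\beta<\lambda$), and let $K$ be the subgroup of $F$ generated by the elements \[ w_{\delta,\nu,n}=2y_{\delta,\nu,n+1}-y_{\delta,\nu,n}-z_{\delta,\zeta_\nu(n)}+x_{\eta_\delta(\nu+n)}\qquad(\delta\in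 S,\ \nu\in E,\ n\in\omega); \] if $\sigma=\aleph_0$, the symbols $z_{\delta,j}$ and the corresponding terms of $w_{\delta,\nu,n}$ are omitted. If $H$ is a group of cardinality $\lambda$ isomorphic to $F/K$ and $A$ is a Whitehead group of cardinality $\mu$, then $\mathrm{Ext}(H,A)\neq 0$. -/

import Mathlib

universe u

open Cardinal Ordinal Set

/-- The generalized continuum hypothesis: `2 ^ κ = κ⁺` for every infinite cardinal `κ`. -/
def GCH : Prop :=
  ∀ κ : Cardinal.{u}, ℵ₀ ≤ κ → (2 : Cardinal.{u}) ^ κ = Order.succ κ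

/-- `Ext(G, C)` for abelian groups: the group `Ext¹` in the category of `ℤ`-modules. -/
abbrev ExtGroup (G C : Type u) [AddCommGroup G] [AddCommGroup C] : Type u :=
  CategoryTheory.Abelian.Ext (ModuleCat.of ℤ G) (ModuleCat.of ℤ C) 1

/-- A Whitehead group is an abelian group `A` with `Ext(A, ℤ) = 0`. -/
def IsWhitehead (A : Type u) [AddCommGroup A] : Prop :=
  Subsingleton (ExtGroup A (ULift.{u} ℤ))

/-- A ladder system of length `ρ` on a set `T` of ordinals below `κ`: for each `δ ∈ T` a strictly
increasing function from `ρ` to `δ` whose range is cofinal in `δ`. -/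
structure LadderSystem {κ : Ordinal.{u}} (ρ : Ordinal.{u}) (T : Set (Iio κ)) where
  ladder : ∀ δ : T, Iio ρ → Iio δ.1.1
  strictMono : ∀ δ, StrictMono (ladder δ)
  isCofinal_range : ∀ δ, IsCofinal (range (ladder δ))

/-- The data from which the group is built, for an infinite cardinal `μ` of cofinality
`σ = μ.ord.cof`: a stationary set `S` of ordinals of cofinality `σ` below `μ⁺`, with a ladder system
`η` of length `σ` on `S`; and, if `σ` is uncountable, a stationary set `E` of ordinals of
cofinality `ω` below `σ`, with a ladder system `ζ` of length `ω` on `E`.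
If `σ = ℵ₀`, then `E = {0}` and there is no `ζ`. -/
structure LadderData (μ : Cardinal.{u}) where
  aleph0_le : ℵ₀ ≤ μ
  S : Set (Iio (Order.succ μ).ord)
  S_stationary : IsStationary S
  S_cof : ∀ δ ∈ S, δ.1.cof = μ.ord.cof
  η : LadderSystem μ.ord.cof.ord S
  E : Set (Iio μ.ord.cof.ord)
  E_stationary : ℵ₀ < μ.ord.cof → IsStationary E
  E_cof : ℵ₀ < μ.ord.cof → ∀ ν ∈ E, ν.1.cof = ℵ₀
  E_countable : μ.ord.cof = ℵ₀ → ∀ ν, ν ∈ E ↔ ν.1 = 0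
  ζ : ℵ₀ < μ.ord.cof → LadderSystem ω E

namespace LadderData

variable {μ : Cardinal.{u}}

/-- The free generators `y_{δ,ν,n}`, `z_{δ,j}` (only if `σ` is uncountable) and `x_β`. -/
inductive Gen (D : LadderData μ) : Type (u + 1)
  | y (δ : D.S) (ν : D.E) (n : ℕ) : Gen D
  | z (hσ : ℵ₀ < μ.ord.cof) (δ : D.S) (j : Iio μ.ord.cof.ord) : Gen D
  | x (β : Iio (Order.succ μ).ord) : Gen D

/-- The free abelian group `F` on the generators. -/
abbrev F (D : LadderData μ) : Type (u + 1) := D.Gen →₀ ℤ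

/-- A generator as an element of `F`. -/
noncomputable abbrev gen (D : LadderData μ) (g : D.Gen) : D.F := Finsupp.single g 1

theorem add_nat_lt (D : LadderData μ) (ν : Iio μ.ord.cof.ord) (n : ℕ) :
    ν.1 + (n : Ordinal.{u}) < μ.ord.cof.ord := by
  have hσ : ℵ₀ ≤ μ.ord.cof := by
    rw [aleph0_le_cof_iff, one_lt_cof_iff]
    exact isSuccLimit_ord D.aleph0_le
  have hω : ω ≤ μ.ord.cof.ord := by
    rw [← ord_aleph0]
    exact ord_le_ord.2 hσ
  exact (isPrincipal_add_ord hσ) ν.2 ((natCast_lt_omega0 n).trans_le hω)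

/-- The ordinal `η_δ(ν + n)`, as an ordinal below `μ⁺`. -/
def etaAdd (D : LadderData μ) (δ : D.S) (ν : D.E) (n : ℕ) : Iio (Order.succ μ).ord :=
  ⟨(D.η.ladder δ ⟨ν.1.1 + n, D.add_nat_lt ν.1 n⟩).1,
    mem_Iio.2 (lt_trans (mem_Iio.1 (D.η.ladder δ _).2) (mem_Iio.1 δ.1.2))⟩

/-- The ordinal `ζ_ν(n)`, as an ordinal below `σ`. -/
def zetaNat (D : LadderData μ) (hσ : ℵ₀ < μ.ord.cof) (ν : D.E) (n : ℕ) : Iio μ.ord.cof.ord :=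
  ⟨((D.ζ hσ).ladder ν ⟨n, natCast_lt_omega0 n⟩).1,
    mem_Iio.2 (lt_trans (mem_Iio.1 ((D.ζ hσ).ladder ν _).2) (mem_Iio.1 ν.1.2))⟩

open Classical in
/-- The relators `w_{δ,ν,n} = 2 y_{δ,ν,n+1} - y_{δ,ν,n} - z_{δ,ζ_ν(n)} + x_{η_δ(ν+n)}`,
where the term with `z` is omitted if `σ = ℵ₀`. -/
noncomputable def w (D : LadderData μ) (δ : D.S) (ν : D.E) (n : ℕ) : D.F :=
  (2 : ℤ) • D.gen (.y δ ν (n + 1)) - D.gen (.y δ ν n)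
    - (if hσ : ℵ₀ < μ.ord.cof then D.gen (.z hσ δ (D.zetaNat hσ ν n)) else 0)
    + D.gen (.x (D.etaAdd δ ν n))

/-- The subgroup `K` of `F` generated by the relators. -/
noncomputable def K (D : LadderData μ) : AddSubgroup D.F :=
  AddSubgroup.closure {k | ∃ (δ : D.S) (ν : D.E) (n : ℕ), k = D.w δ ν n}

/-- `H` is (isomorphic to) the group `F / K` built on the ladder systems `η` and `ζ`. -/
def IsBuilt (D : LadderData μ) (H : Type u) [AddCommGroup H] : Prop :=
  Nonempty (H ≃+ D.F ⧸ D.K)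

end LadderData

/-!
If `Ext(H, A) = 0`, then every homomorphism `K → A` extends to `F`. Hence the equations
`2 y_{δ,ν,n+1} - y_{δ,ν,n} - z_{δ,ζ_ν(n)} + x_{η_δ(ν+n)} = a_{δ,ν,n}` are solvable in `A` for every
choice of right-hand sides. This is refuted by guessing the values of `x` along the ladders.

Suppose that, for one `δ`, each `x_{η_δ(i)}` is confined to a set of size less than `μ`. Then some
right-hand sides make the equations for `δ` unsolvable. If `σ > ℵ₀`, filter `A` by `σ` sets of size
less than `μ`. Some `ν ∈ E` is closed under the ranks of the `z_{δ,j}`, so the `z_{δ,ζ_ν(n)}` are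
confined to a set of size less than `μ` that does not depend on `z`. A nonzero homomorphism
`ψ : A → ℤ` kills this set and the values of `x`, and turns the equations for `ν` into
`2 u_{n+1} - u_n = ψ(a_n)`, which has no integral solution for a suitable periodic sequence `a`.
If `σ = ℵ₀`, there is no `z`, and `y_0` is determined modulo `2 ^ n` by the first `n` of the `x`
and `a`; since `A / 2A` has size `μ`, the `a_n` can be chosen to exclude ever more values of `y_0`.
Both cases rest on lifting homomorphisms `A → ℤ/q` to `ℤ`, which shows that the Whitehead group `A`
is torsion-free and Hausdorff in the `c`-adic topologies and so that `A / cA` is large.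

A guess is a function `g : σ → σ` of ranks, and there are at most `μ` of them. Take a solution for
the right-hand sides that belong to each guess. As `2 ^ μ = μ⁺`, the joint values of these `x` at
`β` are coded by an ordinal below `μ⁺`. For a `δ ∈ S` closed under `β ↦ code of β`, the codes at
`η_δ(i)` lie below `δ`, and their ranks in a filtration of `δ` by `σ` sets of size less than `μ`
form a guess that is correct at `δ`.
-/

universe v

theorem GCH.isStrongLimit (hGCH : GCH.{u}) {μ : Cardinal.{u}} (hμ : μ.IsSingular) :
    μ.IsStrongLimit := by
  refine ⟨hμ.pos.ne', fun κ hκ => ?_⟩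
  rcases lt_or_ge κ ℵ₀ with h | h
  · exact (power_lt_aleph0 (natCast_lt_aleph0 (n := 2)) h).trans_le hμ.aleph0_le
  · rw [hGCH κ h]
    exact hμ.isSuccLimit.succ_lt hκ

theorem power_lt_of_isStrongLimit {μ κ θ : Cardinal.{u}} (hμ : μ.IsStrongLimit)
    (hκ : κ < μ) (hθ : θ < μ) : κ ^ θ < μ :=
  calc κ ^ θ ≤ (2 ^ κ) ^ θ := power_le_power_right (cantor κ).le
    _ = 2 ^ (κ * θ) := (power_mul ..).symm
    _ < μ := hμ.isStrongPrelimit (mul_lt_of_lt hμ.aleph0_le hκ hθ)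

theorem mk_union_lt {α : Type u} {μ : Cardinal.{u}} (hμ : ℵ₀ ≤ μ) {s t : Set α}
    (hs : #s < μ) (ht : #t < μ) : #(s ∪ t : Set α) < μ :=
  (mk_union_le s t).trans_lt (add_lt_of_lt hμ hs ht)

theorem mk_iUnion_lt {ι : Type v} {α : Type u} {μ : Cardinal.{u}} (hμ : ℵ₀ ≤ μ)
    (hι : Cardinal.lift.{u} #ι < Cardinal.lift.{v} μ.ord.cof) {X : ι → Set α}
    (hX : ∀ i, #(X i) < μ) : #(⋃ i, X i) < μ := by
  rw [← Cardinal.lift_lt.{u, v}]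
  refine (mk_iUnion_le_lift X).trans_lt (mul_lt_of_lt (by simpa) ?_ ?_)
  · exact hι.trans_le (Cardinal.lift_le.2 (cof_ord_le μ))
  · refine Cardinal.lift_iSup_lt_of_lt_cof_ord ?_ fun i => Cardinal.lift_lt.2 (hX i)
    rwa [Cardinal.lift_id'.{v, u}, Cardinal.lift_umax.{v, u}, ← lift_ord, ← lift_cof]

theorem aleph0_le_cof_ord {μ : Cardinal.{u}} (hμ : ℵ₀ ≤ μ) : ℵ₀ ≤ μ.ord.cof := by
  rw [aleph0_le_cof_iff, one_lt_cof_iff]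
  exact isSuccLimit_ord hμ

theorem mk_closure_lt {A : Type u} [AddCommGroup A] {μ : Cardinal.{u}} (hμ : ℵ₀ < μ)
    {s : Set A} (hs : #s < μ) : #(AddSubgroup.closure s) < μ := by
  have hspan : (AddSubgroup.closure s : Set A) =
      range (Finsupp.linearCombination ℤ ((↑) : s → A)) := by
    rw [← Submodule.span_int_eq_addSubgroupClosure, Submodule.coe_toAddSubgroup,
      Finsupp.span_eq_range_linearCombination, LinearMap.coe_range]
  calc #(AddSubgroup.closure s)
      = #(range (Finsupp.linearCombination ℤ ((↑) : s → A))) := by rw [← hspan]; rfl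
    _ ≤ #(s →₀ ℤ) := mk_range_le
    _ < μ := by
      rcases isEmpty_or_nonempty s with _ | _
      · rw [mk_eq_one]
        exact one_lt_aleph0.trans hμ
      · rw [mk_finsupp_lift_of_infinite']
        simp [hs, hμ]

theorem exists_rank_mk_lt {μ : Cardinal.{u}} (hμ : ℵ₀ ≤ μ) {T : Type v}
    (hT : Cardinal.lift.{u} #T ≤ Cardinal.lift.{v} μ) :
    ∃ r : T → Iio μ.ord.cof.ord, ∀ i, Cardinal.lift.{u} #{t | r t ≤ i} < Cardinal.lift.{v} μ := by
  obtain ⟨s, hs, hs'⟩ := Ordinal.exists_ord_cof_eq μ.ord.ToType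
  rw [cof_toType, ← type_toType μ.ord.cof.ord, type_eq] at hs'
  let e : s ≃o Iio μ.ord.cof.ord := (OrderIso.ofRelIsoLT hs'.some).trans ToType.mk.symm
  obtain ⟨j⟩ : Nonempty (T ↪ μ.ord.ToType) := by rwa [← lift_mk_le', mk_ord_toType]
  choose c hc hjc using fun t => hs (j t)
  refine ⟨fun t => e ⟨c t, hc t⟩, fun i => ?_⟩
  have hj (t : {t | e ⟨c t, hc t⟩ ≤ i}) : j t ∈ Iic (e.symm i).1 :=
    (hjc t).trans (e.le_symm_apply.2 t.2 : (⟨c t, hc t⟩ : s) ≤ e.symm i)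
  have hinj : Function.Injective fun t : {t | e ⟨c t, hc t⟩ ≤ i} =>
      (⟨j t, hj t⟩ : Iic (e.symm i).1) :=
    fun _ _ h => Subtype.ext (j.injective (congrArg Subtype.val h))
  refine (lift_mk_le_lift_mk_of_injective hinj).trans_lt (Cardinal.lift_lt.2 ?_)
  rw [← Iio_insert]
  refine mk_insert_le.trans_lt (add_lt_of_lt hμ ?_ (one_lt_aleph0.trans_le hμ))
  exact (mk_Iio_lt _ (by simp)).trans_eq (mk_ord_toType μ)

theorem exists_forall_lt_of_mk_lt_cof {α : Type*} [LinearOrder α] {s : Set α}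
    (hs : #s < Order.cof α) : ∃ b, ∀ x ∈ s, x < b := by
  by_contra! h
  exact (Order.cof_le (s := s) h).not_gt hs

theorem isClub_setOf_forall_lt {α : Type*} [LinearOrder α] [WellFoundedLT α]
    (hα : ℵ₀ < Order.cof α) (hIio : ∀ a : α, #(Iio a) < Order.cof α) (h : α → α) :
    IsClub {δ | ∀ β < δ, h β < δ} := by
  refine ⟨fun d hd _ _ a ha β hβ => ?_, fun a => ?_⟩
  · obtain ⟨x, hx, hβx⟩ := (lt_isLUB_iff ha).1 hβ
    exact (hd hx β hβx).trans_le (ha.1 hx)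
  · have hstep (b : α) : ∃ b', ∀ β < b, h β < b' := by
      obtain ⟨b', hb'⟩ := exists_forall_lt_of_mk_lt_cof (mk_image_le.trans_lt (hIio b))
      exact ⟨b', fun β hβ => hb' _ (mem_image_of_mem h hβ)⟩
    choose f hf using hstep
    have hbdd : BddAbove (range fun n => f^[n] a) := by
      have hcard : #(range fun n => f^[n] a) ≤ ℵ₀ := mk_le_aleph0_iff.2 (countable_range _)
      obtain ⟨b, hb⟩ := exists_forall_lt_of_mk_lt_cof (hcard.trans_lt hα)
      exact ⟨b, fun x hx => (hb x hx).le⟩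
    obtain ⟨δ, hδ, hmin⟩ := WellFounded.has_min (wellFounded_lt (α := α)) _ hbdd
    refine ⟨δ, fun β hβ => ?_, hδ ⟨0, rfl⟩⟩
    obtain ⟨_, ⟨n, rfl⟩, hn⟩ : ∃ x ∈ range fun n => f^[n] a, β < x := by
      by_contra! hβub
      exact hmin β hβub hβ
    refine (hf _ β hn).trans_le ?_
    rw [← Function.iterate_succ_apply' f]
    exact hδ ⟨n + 1, rfl⟩

theorem exists_mem_forall_lt_of_isStationary {κ : Cardinal.{u}} (hκ : κ.IsRegular)
    (hκ' : ℵ₀ < κ) {T : Set (Iio κ.ord)} (hT : IsStationary T) (h : Iio κ.ord → Iio κ.ord) :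
    ∃ δ ∈ T, ∀ β < δ, h β < δ := by
  have hcof : Order.cof (Iio κ.ord) = Cardinal.lift.{u + 1} κ := by
    rw [Ordinal.cof_Iio, ← Ordinal.lift_cof, hκ.cof_ord]
  refine hT (isClub_setOf_forall_lt (by simpa [hcof]) (fun a => ?_) h)
  calc #(Iio a) ≤ #(Iio a.1) := mk_le_of_injective (f := fun b => ⟨b.1.1, b.2⟩) fun _ _ hab => by
        simpa [Subtype.ext_iff] using hab
    _ = Cardinal.lift.{u + 1} a.1.card := Cardinal.mk_Iio_ordinal _
    _ < Order.cof (Iio κ.ord) := by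
        rw [hcof, Cardinal.lift_lt, ← lt_ord]
        exact a.2

open CategoryTheory in
theorem exists_lift_of_subsingleton_ext {A L M N : Type u} [AddCommGroup A] [AddCommGroup L]
    [AddCommGroup M] [AddCommGroup N] (h : Subsingleton (ExtGroup A L)) (f : L →ₗ[ℤ] M)
    (g : M →ₗ[ℤ] N) (hf : Function.Injective f) (hfg : Function.Exact f g)
    (hg : Function.Surjective g) (φ : A →ₗ[ℤ] N) : ∃ ψ : A →ₗ[ℤ] M, g ∘ₗ ψ = φ := by
  let S := ModuleCat.shortComplexOfCompEqZero f g hfg.linearMap_comp_eq_zero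
  have hS : S.ShortExact := ModuleCat.shortComplex_shortExact S hfg hf hg
  obtain ⟨x, hx⟩ := Abelian.Ext.covariant_sequence_exact₃ (X := ModuleCat.of ℤ A) hS
    (Abelian.Ext.mk₀ (ModuleCat.ofHom φ)) (zero_add 1) (h.elim _ _)
  obtain ⟨ψ, rfl⟩ := (Abelian.Ext.mk₀_bijective _ _).2 x
  rw [Abelian.Ext.mk₀_comp_mk₀] at hx
  have hψ := (Abelian.Ext.mk₀_bijective _ _).1 hx
  exact ⟨ψ.hom, by simpa [S] using congrArg ModuleCat.Hom.hom hψ⟩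

open CategoryTheory in
theorem exists_extend_of_subsingleton_ext {H A L M : Type u} [AddCommGroup A] [AddCommGroup L]
    [AddCommGroup M] [AddCommGroup H] (h : Subsingleton (ExtGroup H A)) (f : L →ₗ[ℤ] M)
    (g : M →ₗ[ℤ] H) (hf : Function.Injective f) (hfg : Function.Exact f g)
    (hg : Function.Surjective g) (φ : L →ₗ[ℤ] A) : ∃ ψ : M →ₗ[ℤ] A, ψ ∘ₗ f = φ := by
  let S := ModuleCat.shortComplexOfCompEqZero f g hfg.linearMap_comp_eq_zero
  have hS : S.ShortExact := ModuleCat.shortComplex_shortExact S hfg hf hg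
  obtain ⟨x, hx⟩ := Abelian.Ext.contravariant_sequence_exact₁ (Y := ModuleCat.of ℤ A) hS
    (Abelian.Ext.mk₀ (ModuleCat.ofHom φ)) (add_zero 1) (h.elim _ _)
  obtain ⟨ψ, rfl⟩ := (Abelian.Ext.mk₀_bijective _ _).2 x
  rw [Abelian.Ext.mk₀_comp_mk₀] at hx
  have hψ := (Abelian.Ext.mk₀_bijective _ _).1 hx
  exact ⟨ψ.hom, by simpa [S] using congrArg ModuleCat.Hom.hom hψ⟩

theorem exists_extend_of_subsingleton_ext_of_small {H A : Type u} {L M : Type v} [AddCommGroup A]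
    [AddCommGroup L] [AddCommGroup M] [AddCommGroup H] [Small.{u} L] [Small.{u} M]
    (h : Subsingleton (ExtGroup H A)) (f : L →ₗ[ℤ] M)
    (g : M →ₗ[ℤ] H) (hf : Function.Injective f) (hfg : Function.Exact f g)
    (hg : Function.Surjective g) (φ : L →ₗ[ℤ] A) : ∃ ψ : M →ₗ[ℤ] A, ψ ∘ₗ f = φ := by
  let eL := Shrink.linearEquiv.{u} ℤ L
  let eM := Shrink.linearEquiv.{u} ℤ M
  let f' := eM.symm.toLinearMap ∘ₗ f ∘ₗ eL.toLinearMap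
  let g' := g ∘ₗ eM.toLinearMap
  have hfg' : Function.Exact f' g' := fun x => by
    have hx : x ∈ range f' ↔ eM x ∈ range f :=
      ⟨fun ⟨l, hl⟩ => ⟨eL l, by simp [← hl, f']⟩,
        fun ⟨l, hl⟩ => ⟨eL.symm l, by simp [f', hl]⟩⟩
    exact (hfg (eM x)).trans hx.symm
  obtain ⟨ψ, hψ⟩ := exists_extend_of_subsingleton_ext h f' g'
    (eM.symm.injective.comp (hf.comp eL.injective)) hfg' (hg.comp eM.surjective)
    (φ ∘ₗ eL.toLinearMap)
  refine ⟨ψ ∘ₗ eM.symm.toLinearMap, LinearMap.ext fun l => ?_⟩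
  simpa [f'] using LinearMap.congr_fun hψ (eL.symm l)

open CategoryTheory in
theorem injective_moduleCat_of_divisibleBy (Q : Type u) [AddCommGroup Q] [DivisibleBy Q ℤ] :
    Injective (ModuleCat.of ℤ Q) :=
  have := (Module.Baer.of_divisible Q).injective
  Module.injective_object_of_injective_module ℤ Q

open CategoryTheory in
theorem hasInjectiveDimensionLT_two_ulift_int :
    HasInjectiveDimensionLT (ModuleCat.of ℤ (ULift.{u} ℤ)) 2 := by
  let f : ULift.{u} ℤ →ₗ[ℤ] ULift.{u} ℚ :=
    ULift.moduleEquiv.symm.toLinearMap ∘ₗ (Int.castAddHom ℚ).toIntLinearMap ∘ₗ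
      ULift.moduleEquiv.toLinearMap
  have hf : Function.Injective f :=
    ULift.up_injective.comp (Int.cast_injective.comp ULift.down_injective)
  have hS := ModuleCat.shortComplex_shortExact
    (ModuleCat.shortComplexOfCompEqZero f (LinearMap.range f).mkQ f.range_mkQ_comp)
    f.exact_map_mkQ_range hf (Submodule.mkQ_surjective _)
  have : DivisibleBy (ULift.{u} ℚ ⧸ LinearMap.range f) ℤ :=
    (Submodule.mkQ_surjective (LinearMap.range f)).divisibleBy _ fun _ _ => map_zsmul _ _ _
  have := injective_moduleCat_of_divisibleBy (ULift.{u} ℚ ⧸ LinearMap.range f)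
  have := injective_moduleCat_of_divisibleBy (ULift.{u} ℚ)
  exact (hS.hasInjectiveDimensionLT_X₃_iff 0 this).1 inferInstance

namespace IsWhitehead

variable {A : Type u} [AddCommGroup A]

open CategoryTheory in
theorem of_injective {B : Type u} [AddCommGroup B] (hA : IsWhitehead A) (f : B →ₗ[ℤ] A)
    (hf : Function.Injective f) : IsWhitehead B := by
  have hS := ModuleCat.shortComplex_shortExact
    (ModuleCat.shortComplexOfCompEqZero f (LinearMap.range f).mkQ f.range_mkQ_comp)
    f.exact_map_mkQ_range hf (Submodule.mkQ_surjective _)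
  have hExt2 : Subsingleton (Abelian.Ext (ModuleCat.of ℤ (A ⧸ LinearMap.range f))
      (ModuleCat.of ℤ (ULift.{u} ℤ)) 2) :=
    have := hasInjectiveDimensionLT_two_ulift_int.{u}
    HasInjectiveDimensionLT.subsingleton _ 2 2 le_rfl _
  have hsurj := fun x => Abelian.Ext.contravariant_sequence_exact₁ hS
    (ModuleCat.of ℤ (ULift.{u} ℤ)) x one_add_one_eq_two (hExt2.elim _ _)
  refine ⟨fun x y => ?_⟩
  obtain ⟨x, rfl⟩ := hsurj x
  obtain ⟨y, rfl⟩ := hsurj y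
  rw [hA.elim x y]

theorem exists_lift_zmod (hA : IsWhitehead A) {n : ℕ} (hn : n ≠ 0) (χ : A →+ ZMod n) :
    ∃ ψ : A →+ ℤ, ∀ a, (ψ a : ZMod n) = χ a := by
  let f : ULift.{u} ℤ →ₗ[ℤ] ULift.{u} ℤ := (n : ℤ) • LinearMap.id
  let g : ULift.{u} ℤ →ₗ[ℤ] ULift.{u} (ZMod n) :=
    ULift.moduleEquiv.symm.toLinearMap ∘ₗ (Int.castAddHom (ZMod n)).toIntLinearMap ∘ₗ
      ULift.moduleEquiv.toLinearMap
  have hf : Function.Injective f := fun x y hxy =>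
    ULift.ext _ _ (mul_left_cancel₀ (Int.natCast_ne_zero.2 hn) (congrArg ULift.down hxy))
  have hfg : Function.Exact f g := by
    intro x
    trans (n : ℤ) ∣ x.down
    · rw [← ZMod.intCast_zmod_eq_zero_iff_dvd]
      exact ⟨congrArg ULift.down, ULift.ext _ _⟩
    · exact ⟨fun ⟨k, hk⟩ => ⟨⟨k⟩, ULift.ext _ _ (by simp [f, hk])⟩,
        fun ⟨y, hy⟩ => ⟨y.down, by simp [f, ← hy]⟩⟩
  have hg : Function.Surjective g :=
    ULift.up_surjective.comp (ZMod.intCast_surjective.comp ULift.down_surjective)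
  obtain ⟨ψ, hψ⟩ := exists_lift_of_subsingleton_ext hA f g hf hfg hg
    (ULift.moduleEquiv.symm.toLinearMap ∘ₗ χ.toIntLinearMap)
  exact ⟨(ULift.moduleEquiv.toLinearMap ∘ₗ ψ).toAddMonoidHom, fun a =>
    congrArg ULift.down (LinearMap.congr_fun hψ a)⟩

end IsWhitehead

section Divisibility

variable {A : Type u} [AddCommGroup A] {c p : ℕ}

/-- The subgroup `cA` of an abelian group `A`, whose cosets are the digits of `c`-adic expansions in
`A`. -/
abbrev nsmulRange (c : ℕ) (A : Type*) [AddCommGroup A] : AddSubgroup A :=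
  (nsmulAddMonoidHom (α := A) c).range

theorem int_eq_zero_of_forall_pow_dvd {d m : ℤ} (hd : 1 < d) (h : ∀ k : ℕ, d ^ k ∣ m) : m = 0 := by
  by_contra hm
  have hfin : FiniteMultiplicity d m := Int.finiteMultiplicity_iff.2 ⟨by lia, hm⟩
  obtain ⟨k, hk⟩ := hfin
  exact hk (h (k + 1))

theorem eq_zero_of_pow_smul_eq [IsAddTorsionFree A] (hp : p.Prime) (hpc : ¬ p ∣ c) {x : A} {k : ℕ}
    {m : ℤ} (h : c ^ k • x = m • p • x) : x = 0 := by
  have hzero : ((c : ℤ) ^ k - m * p) • x = 0 := by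
    rw [sub_smul, mul_smul, natCast_zsmul, ← h]
    norm_cast
    exact sub_self _
  refine (smul_eq_zero.1 hzero).resolve_left fun hk => hpc (hp.dvd_of_dvd_pow (n := k) ?_)
  have hdvd : (p : ℤ) ∣ (c : ℤ) ^ k := ⟨m, by linarith⟩
  exact_mod_cast hdvd

theorem exists_hom_zmod_apply_ne_zero [Fact p.Prime] [Module (ZMod p) A] {a : A} (ha : a ≠ 0) :
    ∃ χ : A →+ ZMod p, χ a ≠ 0 :=
  let ⟨f, hf⟩ := Module.Projective.exists_dual_ne_zero (ZMod p) ha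
  ⟨f, hf⟩

theorem exists_hom_zmod_apply_ne_zero_of_notMem [Fact p.Prime] {a : A}
    (ha : a ∉ nsmulRange p A) : ∃ χ : A →+ ZMod p, χ a ≠ 0 := by
  let : Module (ZMod p) (A ⧸ nsmulRange p A) := QuotientAddGroup.zmodModule fun a => ⟨a, rfl⟩
  have h0 : (QuotientAddGroup.mk a : A ⧸ nsmulRange p A) ≠ 0 := by
    rwa [Ne, QuotientAddGroup.eq_zero_iff]
  obtain ⟨χ, hχ⟩ := exists_hom_zmod_apply_ne_zero (p := p) h0
  exact ⟨χ.comp (QuotientAddGroup.mk' _), hχ⟩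

theorem mk_quotient_nsmulRange_le [Fact p.Prime] :
    #(A ⧸ nsmulRange p A) ≤ (p : Cardinal.{u}) ^ #(A →+ ZMod p) := by
  have hinj : Function.Injective fun (q : A ⧸ nsmulRange p A) (χ : A →+ ZMod p) => χ q.out := by
    intro q q' h
    by_contra hne
    have hmem : q.out - q'.out ∉ nsmulRange p A := fun hmem => hne <| by
      rw [← Quotient.out_eq' q, ← Quotient.out_eq' q']
      exact (QuotientAddGroup.eq.2 (by rwa [neg_add_eq_sub])).symm
    obtain ⟨χ, hχ⟩ := exists_hom_zmod_apply_ne_zero_of_notMem hmem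
    exact hχ (by simpa [sub_eq_zero] using congrFun h χ)
  simpa using mk_le_of_injective hinj

-- An element of a group that is Hausdorff in the `c`-adic topology is determined by the sequence
-- of its `c`-adic digits, which are cosets of `cA`.
theorem mk_le_mk_quotient_power_aleph0 (hdiv : ∀ a : A, (∀ n, ∃ b : A, c ^ n • b = a) → a = 0) :
    #A ≤ #(A ⧸ nsmulRange c A) ^ ℵ₀ := by
  have hrem (a : A) : ∃ d : A, a - (QuotientAddGroup.mk a : A ⧸ nsmulRange c A).out = c • d := by
    obtain ⟨d, hd⟩ := QuotientAddGroup.eq.1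
      (Quotient.out_eq' (QuotientAddGroup.mk a : A ⧸ nsmulRange c A))
    exact ⟨d, (neg_add_eq_sub _ _).symm.trans hd.symm⟩
  choose d hd using hrem
  have hinj : Function.Injective fun (a : A) (n : ℕ) =>
      (QuotientAddGroup.mk (d^[n] a) : A ⧸ nsmulRange c A) := by
    intro a a' h
    have hsub (n : ℕ) : c ^ n • (d^[n] a - d^[n] a') = a - a' := by
      induction n with
      | zero => simp
      | succ n ih =>
        have hdigit : (QuotientAddGroup.mk (d^[n] a) : A ⧸ nsmulRange c A) =
          QuotientAddGroup.mk (d^[n] a') := congrFun h n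
        rw [← ih, pow_succ, mul_smul, Function.iterate_succ_apply', Function.iterate_succ_apply',
          smul_sub c, ← hd, ← hd, hdigit, sub_sub_sub_cancel_right]
    exact sub_eq_zero.1 (hdiv _ fun n => ⟨_, hsub n⟩)
  simpa using mk_le_of_injective hinj

end Divisibility

namespace IsWhitehead

variable {A : Type u} [AddCommGroup A] {μ : Cardinal.{u}} {c : ℕ}

theorem isAddTorsionFree (hA : IsWhitehead A) : IsAddTorsionFree A := by
  refine IsAddTorsionFree.of_not_isOfFinAddOrder fun a ha hfin => ha ?_
  let B := AddSubgroup.zmultiples a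
  have : Finite B := finite_zmultiples.2 hfin
  have hB : IsWhitehead B := hA.of_injective B.subtype.toIntLinearMap Subtype.val_injective
  let e : ZMod (Nat.card B) ≃+ B := zmodAddCyclicAddEquiv inferInstance
  obtain ⟨ψ, hψ⟩ := hB.exists_lift_zmod Nat.card_pos.ne' e.symm.toAddMonoidHom
  have hψ0 (b : B) : ψ b = 0 := by
    have hb : Nat.card B • ψ b = 0 := by rw [← map_nsmul, card_nsmul_eq_zero', map_zero]
    exact (smul_eq_zero.1 hb).resolve_left Nat.card_pos.ne'
  have he : e.symm ⟨a, AddSubgroup.mem_zmultiples a⟩ = 0 := by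
    simpa [hψ0] using (hψ ⟨a, AddSubgroup.mem_zmultiples a⟩).symm
  exact congrArg Subtype.val ((map_eq_zero_iff _ e.symm.injective).1 he)

-- Homomorphisms to `ℤ` vanish at `a`, so no homomorphism to `ℤ/q` that is nonzero at `a` lifts to
-- `ℤ`. Such homomorphisms exist on the subgroup `B` generated by the quotients of `a` by powers of
-- `c`, where `a` is not divisible by a prime `q` that does not divide `c`.
theorem eq_zero_of_forall_pow_nsmul (hA : IsWhitehead A) (hc : 1 < c) {a : A}
    (h : ∀ n, ∃ b : A, c ^ n • b = a) : a = 0 := by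
  by_contra ha
  have := hA.isAddTorsionFree
  let B : AddSubgroup A :=
    { carrier := {x | ∃ (k : ℕ) (m : ℤ), c ^ k • x = m • a}
      zero_mem' := ⟨0, 0, by simp⟩
      add_mem' := by
        rintro x y ⟨k, m, hx⟩ ⟨l, n, hy⟩
        refine ⟨k + l, c ^ l * m + c ^ k * n, ?_⟩
        rw [smul_add, add_smul, pow_add, mul_smul (c ^ k) (c ^ l) y, hy, mul_comm (c ^ k), mul_smul,
          hx, mul_smul, mul_smul]
        norm_cast
      neg_mem' := by
        rintro x ⟨k, m, hx⟩
        exact ⟨k, -m, by simp [hx]⟩ }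
  have hB : IsWhitehead B := hA.of_injective B.subtype.toIntLinearMap Subtype.val_injective
  let a' : B := ⟨a, 0, 1, by simp⟩
  have hψ (ψ : B →+ ℤ) : ψ a' = 0 := by
    refine int_eq_zero_of_forall_pow_dvd (d := c) (by exact_mod_cast hc) fun k => ?_
    obtain ⟨b, hb⟩ := h k
    let b' : B := ⟨b, k, 1, by simpa⟩
    have hb' : c ^ k • b' = a' := Subtype.ext hb
    exact ⟨ψ b', by rw [← hb', map_nsmul]; simp⟩
  let q := (c + 1).minFac
  have hq : q.Prime := Nat.minFac_prime (by omega)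
  have hqc : ¬ q ∣ c := fun h =>
    hq.one_lt.ne' (Nat.dvd_one.1 ((Nat.dvd_add_right h).1 (Nat.minFac_dvd _)))
  have := Fact.mk hq
  have ha' : a' ∉ nsmulRange q B := by
    rintro ⟨⟨x, k, m, hx⟩, hxa⟩
    have hxa : q • x = a := congrArg Subtype.val hxa
    exact ha (by rw [← hxa, eq_zero_of_pow_smul_eq hq hqc (hx.trans (by rw [hxa])), smul_zero])
  obtain ⟨χ, hχ⟩ := exists_hom_zmod_apply_ne_zero_of_notMem ha'
  obtain ⟨ψ, hψχ⟩ := hB.exists_lift_zmod hq.ne_zero χ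
  exact hχ (by rw [← hψχ, hψ, Int.cast_zero])

theorem le_mk_quotient (hA : IsWhitehead A) (hc : 1 < c) (hμ : μ.IsStrongLimit) (hunc : ℵ₀ < μ)
    (hcard : μ ≤ #A) : μ ≤ #(A ⧸ nsmulRange c A) := by
  by_contra! hlt
  have hle : #A ≤ #(A ⧸ nsmulRange c A) ^ ℵ₀ :=
    mk_le_mk_quotient_power_aleph0 fun a => hA.eq_zero_of_forall_pow_nsmul hc
  exact (hcard.trans hle).not_gt (power_lt_of_isStrongLimit hμ hlt hunc)

theorem exists_ne_zero_forall_apply_eq_zero (hA : IsWhitehead A) (hμ : μ.IsStrongLimit)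
    (hunc : ℵ₀ < μ) (hcard : μ ≤ #A) {X : Set A} (hX : #X < μ) :
    ∃ ψ : A →+ ℤ, ψ ≠ 0 ∧ ∀ x ∈ X, ψ x = 0 := by
  by_contra! H
  choose L hL using hA.exists_lift_zmod two_ne_zero
  have hinj : Function.Injective fun (χ : A →+ ZMod 2) (x : X) => L χ x := by
    intro χ χ' h
    have hLL : L χ - L χ' = 0 := by
      by_contra hne
      obtain ⟨x, hx, hx'⟩ := H _ hne
      exact hx' (sub_eq_zero.2 (congrFun h ⟨x, hx⟩))
    ext a
    rw [← hL, ← hL, sub_eq_zero.1 hLL]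
  have hdual : #(A →+ ZMod 2) < μ :=
    calc #(A →+ ZMod 2) ≤ ℵ₀ ^ #X := by simpa using mk_le_of_injective hinj
      _ < μ := power_lt_of_isStrongLimit hμ hunc hX
  refine (hA.le_mk_quotient one_lt_two hμ hunc hcard).not_gt ?_
  exact mk_quotient_nsmulRange_le.trans_lt (by simpa using hμ.isStrongPrelimit hdual)

end IsWhitehead

section TowerEquations

variable {A : Type u} [AddCommGroup A] {c : ℕ}

/-- Solvability of the tower of equations `c y_{n+1} - y_n + x_n = a_n` with `x_n` confined to a
prescribed set `X_n`. With `c = 2`, this is what the relators `w_{δ,ν,n}` for fixed `δ` and `ν`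
ask of a homomorphism from the free group to `A` that sends `w_{δ,ν,n}` to `a_n`. -/
def TowerSolvable (c : ℕ) (X : ℕ → Set A) (a : ℕ → A) : Prop :=
  ∃ y x : ℕ → A, (∀ n, x n ∈ X n) ∧ ∀ n, c • y (n + 1) - y n + x n = a n

-- `v k = (c ^ 2 - 1) u (2 k) - t` satisfies `v k = c ^ 2 v (k + 1)`, so `v 0` is divisible by all
-- powers of `c ^ 2`.
theorem mul_eq_of_forall_mul_sub_eq_ite {c : ℤ} (hc : 1 < c) {u : ℕ → ℤ} {t : ℤ}
    (h : ∀ n, c * u (n + 1) - u n = if Even n then t else 0) : (c ^ 2 - 1) * u 0 = t := by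
  have hstep (k : ℕ) : (c ^ 2 - 1) * u (2 * k) - t =
      c ^ 2 * ((c ^ 2 - 1) * u (2 * (k + 1)) - t) := by
    have heven : c * u (2 * k + 1) - u (2 * k) = t := by simp [h]
    have hodd : c * u (2 * k + 1 + 1) - u (2 * k + 1) = 0 := by simp [h]
    rw [show 2 * (k + 1) = 2 * k + 1 + 1 by ring]
    linear_combination -(c ^ 2 - 1) * heven - c * (c ^ 2 - 1) * hodd
  have hpow (k : ℕ) : (c ^ 2 - 1) * u 0 - t = (c ^ 2) ^ k * ((c ^ 2 - 1) * u (2 * k) - t) := by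
    induction k with
    | zero => simp
    | succ k ih => rw [ih, hstep, pow_succ _ k, mul_assoc]
  exact sub_eq_zero.1 (int_eq_zero_of_forall_pow_dvd (one_lt_pow₀ hc two_ne_zero)
    fun k => ⟨_, hpow k⟩)

theorem exists_not_towerSolvable_of_hom (hc : 1 < c) {ψ : A →+ ℤ} (hψ : ψ ≠ 0) :
    ∃ a : ℕ → A, ¬ TowerSolvable c (fun _ => (ψ.ker : Set A)) a := by
  by_contra! H
  have hc' : (1 : ℤ) < c := by exact_mod_cast hc
  have hdvd (b : A) : ∃ b' : A, ((c : ℤ) ^ 2 - 1) * ψ b' = ψ b := by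
    obtain ⟨y, x, hx, hyx⟩ := H fun n => if Even n then b else 0
    refine ⟨y 0, mul_eq_of_forall_mul_sub_eq_ite (u := fun n => ψ (y n)) hc' fun n => ?_⟩
    have hn := congrArg ψ (hyx n)
    rw [map_add, map_sub, map_nsmul, AddMonoidHom.mem_ker.1 (hx n), add_zero] at hn
    rw [← nsmul_eq_mul c (ψ _), hn, apply_ite ψ, map_zero]
  refine hψ (AddMonoidHom.ext fun b =>
    int_eq_zero_of_forall_pow_dvd (d := (c : ℤ) ^ 2 - 1) (by nlinarith) fun k => ?_)
  induction k generalizing b with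
  | zero => simp
  | succ k ih =>
    obtain ⟨b', hb'⟩ := hdvd b
    rw [← hb', pow_succ']
    exact mul_dvd_mul_left _ (ih b')

theorem sub_pow_nsmul_mem {G : ℕ → AddSubgroup A} (hG : Monotone G) {y x a : ℕ → A}
    (hx : ∀ n, x n ∈ G n) (ha : ∀ n, a n ∈ G (n + 1))
    (h : ∀ n, c • y (n + 1) - y n + x n = a n) (n : ℕ) : y 0 - c ^ n • y n ∈ G n := by
  induction n with
  | zero => simp
  | succ n ih =>
    have hstep : y 0 - c ^ (n + 1) • y (n + 1) =
        y 0 - c ^ n • y n + c ^ n • (x n - a n) := by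
      rw [← h n, pow_succ, mul_smul, smul_sub, smul_add, smul_sub]
      abel
    have hle := hG n.le_succ
    rw [hstep]
    exact add_mem (hle ih) (nsmul_mem (sub_mem (hle (hx n)) (ha n)) _)

theorem exists_monotone_addSubgroup {μ : Cardinal.{u}} (hμ : ℵ₀ < μ) {X : ℕ → Set A}
    (hX : ∀ n, #(X n) < μ) (f : ℕ → AddSubgroup A → A) :
    ∃ G : ℕ → AddSubgroup A, Monotone G ∧ (∀ n, #(G n) < μ) ∧ (∀ n, X n ⊆ G n) ∧
      ∀ n, f n (G n) ∈ G (n + 1) := by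
  let next (n : ℕ) (G : AddSubgroup A) : Set A := G ∪ (X (n + 1) ∪ {f n G})
  let G : ℕ → AddSubgroup A := fun n =>
    n.rec (AddSubgroup.closure (X 0)) fun n G => AddSubgroup.closure (next n G)
  have hsub (n : ℕ) : next n (G n) ⊆ G (n + 1) := AddSubgroup.subset_closure
  refine ⟨G, monotone_nat_of_le_succ fun n b hb => hsub n (.inl hb), fun n => ?_, fun n => ?_,
    fun n => hsub n (.inr (.inr rfl))⟩
  · induction n with
    | zero => exact mk_closure_lt hμ (hX 0)
    | succ n ih =>
      refine mk_closure_lt hμ (mk_union_lt hμ.le ih (mk_union_lt hμ.le (hX _) ?_))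
      rw [mk_singleton]
      exact one_lt_aleph0.trans hμ
  · cases n with
    | zero => exact AddSubgroup.subset_closure
    | succ n => exact fun b hb => hsub n (.inr (.inl hb))

end TowerEquations

namespace IsWhitehead

variable {A : Type u} [AddCommGroup A] {μ : Cardinal.{u}} {c : ℕ}

theorem exists_not_towerSolvable (hA : IsWhitehead A) (hc : 1 < c)
    (hμ : μ.IsStrongLimit) (hunc : ℵ₀ < μ) (hcard : μ ≤ #A) {X : Set A} (hX : #X < μ) :
    ∃ a : ℕ → A, ¬ TowerSolvable c (fun _ => X) a := by
  obtain ⟨ψ, hψ, hψX⟩ := hA.exists_ne_zero_forall_apply_eq_zero hμ hunc hcard hX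
  obtain ⟨a, ha⟩ := exists_not_towerSolvable_of_hom hc hψ
  exact ⟨a, fun ⟨y, x, hx, h⟩ => ha ⟨y, x, fun n => hψX _ (hx n), h⟩⟩

theorem exists_forall_add_ne (hA : IsWhitehead A) (hc : 1 < c) (hμ : μ.IsStrongLimit)
    (hunc : ℵ₀ < μ) (hcard : μ ≤ #A) (n : ℕ) {G : Set A} (hG : #G < μ) :
    ∃ a : A, ∀ s ∈ G, ∀ b : A, s + c ^ n • a ≠ c ^ (n + 1) • b := by
  have := hA.isAddTorsionFree
  by_contra! H
  choose s hs b hb using H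
  have hinj : Function.Injective fun q : A ⧸ nsmulRange c A => (⟨s q.out, hs _⟩ : G) := by
    intro q q' h
    have hss' : s q.out = s q'.out := congrArg Subtype.val h
    have hsmul : c ^ n • (c • (b q'.out - b q.out)) = c ^ n • (-q.out + q'.out) := by
      rw [← mul_smul, ← pow_succ, smul_sub, ← hb, ← hb, hss', smul_add, smul_neg]
      abel
    rw [← Quotient.out_eq' q, ← Quotient.out_eq' q']
    exact QuotientAddGroup.eq.2 ⟨b q'.out - b q.out,
      nsmul_right_injective (pow_ne_zero n (by omega)) hsmul⟩
  exact ((hA.le_mk_quotient hc hμ hunc hcard).trans (mk_le_of_injective hinj)).not_gt hG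

-- The `a n` are chosen to make `y 0 ∈ B n` impossible, one `n` at a time.
theorem exists_not_towerSolvable_of_forall_exists_mem (hA : IsWhitehead A) (hc : 1 < c)
    (hμ : μ.IsStrongLimit) (hunc : ℵ₀ < μ) (hcard : μ ≤ #A) {B : ℕ → Set A} (hB : ∀ b, ∃ n, b ∈ B n)
    (hBμ : ∀ n, #(B n) < μ) {X : ℕ → Set A} (hX : ∀ n, #(X n) < μ) :
    ∃ a : ℕ → A, ¬ TowerSolvable c X a := by
  have hex (n : ℕ) (G : AddSubgroup A) :
      ∃ a : A, #G < μ → ∀ s ∈ G, ∀ b : A, s + c ^ n • a ≠ c ^ (n + 1) • b := by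
    by_cases hG : #G < μ
    · obtain ⟨a, ha⟩ := hA.exists_forall_add_ne hc hμ hunc hcard n hG
      exact ⟨a, fun _ => ha⟩
    · exact ⟨0, fun h => (hG h).elim⟩
  choose f hf using hex
  obtain ⟨G, hGmono, hGμ, hXG, hfG⟩ := exists_monotone_addSubgroup hunc
    (X := fun n => X n ∪ B n) (fun n => mk_union_lt hunc.le (hX n) (hBμ n)) f
  refine ⟨fun n => f n (G n), ?_⟩
  rintro ⟨y, x, hx, h⟩
  have hxG (n : ℕ) : x n ∈ G n := hXG n (.inl (hx n))
  obtain ⟨n, hn⟩ := hB (y 0)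
  have hy : c ^ n • y n ∈ G n := by
    simpa using sub_mem (hXG n (.inr hn)) (sub_pow_nsmul_mem hGmono hxG hfG h n)
  refine hf n (G n) (hGμ n) (c ^ n • y n - c ^ n • x n)
    (sub_mem hy (nsmul_mem (hxG n) _)) (y (n + 1)) ?_
  rw [← show _ = f n (G n) from h n, pow_succ, mul_smul, smul_add, smul_sub]
  abel

end IsWhitehead

theorem mk_Iio_ord_fun (κ : Cardinal.{u}) :
    #(Iio κ.ord → Iio κ.ord) = Cardinal.lift.{u + 1} (κ ^ κ) := by
  simp [Cardinal.mk_Iio_ordinal]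

theorem nonempty_embedding_Iio_succ_ord {μ : Cardinal.{u}} (hμ : ℵ₀ ≤ μ)
    (hμ2 : (2 : Cardinal.{u}) ^ μ = Order.succ μ) {G : Type (u + 1)}
    (hG : #G ≤ Cardinal.lift.{u + 1} μ) {A : Type u} (hA : #A ≤ μ) :
    Nonempty ((G → A) ↪ Iio (Order.succ μ).ord) := by
  have hA0 : Cardinal.lift.{u + 1} μ ≠ 0 := by simpa using (aleph0_pos.trans_le hμ).ne'
  rw [← Cardinal.le_def, Cardinal.mk_Iio_ordinal, card_ord, ← hμ2, ← power_self_eq hμ,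
    Cardinal.lift_power, mk_pi, prod_const, Cardinal.lift_id'.{u, u + 1}]
  exact (power_le_power_right (Cardinal.lift_le.2 hA)).trans (power_le_power_left hA0 hG)

-- A family of functions `x g` is coded by the map `h` sending `β` to the code below `μ⁺` of
-- `g ↦ x g β`. At a closure point `δ` of `h` the codes of the values `x g (η δ i)` are all below
-- `δ`, so the family is determined on the ladder up to the ranks of these codes, and the values
-- are captured by the guess `g` that lists the ranks.
theorem exists_forall_mem_of_isStationary {μ : Cardinal.{u}} (hμ : ℵ₀ ≤ μ)
    (hμ2 : (2 : Cardinal.{u}) ^ μ = Order.succ μ) {S : Set (Iio (Order.succ μ).ord)}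
    (hS : IsStationary S) {I : Type (u + 1)}
    (hI : #(I → Iio μ.ord.cof.ord) ≤ Cardinal.lift.{u + 1} μ)
    {η : S → I → Iio (Order.succ μ).ord} (hη : ∀ δ i, η δ i < δ.1) {A : Type u} (hA : #A ≤ μ) :
    ∃ X : (I → Iio μ.ord.cof.ord) → S → I → Set A, (∀ g δ i, #(X g δ i) < μ) ∧
      ∀ x : (I → Iio μ.ord.cof.ord) → Iio (Order.succ μ).ord → A,
        ∃ g δ, ∀ i, x g (η δ i) ∈ X g δ i := by
  obtain ⟨c⟩ := nonempty_embedding_Iio_succ_ord hμ hμ2 hI hA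
  have hr (δ : S) := exists_rank_mk_lt hμ (T := Iio δ.1.1) <| by
    rw [Cardinal.mk_Iio_ordinal, Cardinal.lift_lift, Cardinal.lift_le, ← Order.lt_succ_iff,
      ← lt_ord]
    exact δ.1.2
  choose r hr using hr
  refine ⟨fun g δ i => {b | ∃ (f : _ → A) (hf : c f < δ.1), r δ ⟨c f, hf⟩ ≤ g i ∧ f g = b},
    fun g δ i => ?_, fun x => ?_⟩
  · choose f hf hrf hfg using fun b : {b | ∃ (f : _ → A) (hf : c f < δ.1),
      r δ ⟨c f, hf⟩ ≤ g i ∧ f g = b} => b.2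
    have hinj : Function.Injective fun b => (⟨⟨c (f b), hf b⟩, hrf b⟩ : {t | r δ t ≤ g i}) := by
      intro b b' h
      have hff' : f b = f b' := c.injective (Subtype.ext (congrArg (fun t => t.1.1) h))
      exact Subtype.ext (by rw [← hfg, ← hfg, hff'])
    exact Cardinal.lift_lt.1 ((lift_mk_le_lift_mk_of_injective hinj).trans_lt (hr δ (g i)))
  · obtain ⟨δ, hδS, hδ⟩ := exists_mem_forall_lt_of_isStationary (isRegular_succ hμ)
      (Order.lt_succ_of_le hμ) hS fun β => c fun g => x g β
    have hcη (i : I) := hδ _ (hη ⟨δ, hδS⟩ i)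
    exact ⟨fun i => r ⟨δ, hδS⟩ ⟨_, hcη i⟩, ⟨δ, hδS⟩, fun i => ⟨_, hcη i, le_rfl, rfl⟩⟩

namespace LadderData

variable {μ : Cardinal.{u}} (D : LadderData μ)

/-- The ordinal `η_δ(i)`, as an ordinal below `μ⁺`. -/
def eta (δ : D.S) (i : Iio μ.ord.cof.ord) : Iio (Order.succ μ).ord :=
  ⟨(D.η.ladder δ i).1, (mem_Iio.1 (D.η.ladder δ i).2).trans δ.1.2⟩

theorem eta_lt (δ : D.S) (i : Iio μ.ord.cof.ord) : D.eta δ i < δ.1 :=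
  mem_Iio.1 (D.η.ladder δ i).2

/-- The ordinal `ν + n`, as an ordinal below `σ`. -/
def addNat (ν : Iio μ.ord.cof.ord) (n : ℕ) : Iio μ.ord.cof.ord :=
  ⟨ν.1 + n, D.add_nat_lt ν n⟩

theorem zetaNat_lt (hσ : ℵ₀ < μ.ord.cof) (ν : D.E) (n : ℕ) : D.zetaNat hσ ν n < ν.1 :=
  mem_Iio.1 ((D.ζ hσ).ladder ν _).2

open Classical in
/-- For a fixed `δ`, the equations satisfied by the values `x_{η_δ(i)}`, `z_{δ,j}`, `y_{δ,ν,n}` of a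
homomorphism on the generators of `F` if its values on the relators `w_{δ,ν,n}` are `a_{ν,n}`. -/
def IsSolution {A : Type*} [AddCommGroup A] (x z : Iio μ.ord.cof.ord → A) (y a : D.E → ℕ → A) :
    Prop :=
  ∀ ν n, (2 : ℤ) • y ν (n + 1) - y ν n - (if hσ : ℵ₀ < μ.ord.cof then z (D.zetaNat hσ ν n) else 0)
    + x (D.addNat ν.1 n) = a ν n

instance small_gen : Small.{u} D.Gen := by
  let f : D.Gen → (D.S × D.E × ℕ) ⊕ (D.S × Iio μ.ord.cof.ord) ⊕ Iio (Order.succ μ).ord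
    | .y δ ν n => .inl (δ, ν, n)
    | .z _ δ j => .inr (.inl (δ, j))
    | .x β => .inr (.inr β)
  refine small_of_injective (f := f) ?_
  rintro (⟨δ, ν, n⟩ | ⟨h, δ, j⟩ | β) (⟨δ', ν', n'⟩ | ⟨h', δ', j'⟩ | β') heq <;> simp_all [f]

/-- The homomorphism onto `K` from the free group on the indices of the relators. It is an
isomorphism, so that homomorphisms on `K` may be prescribed on the relators. -/
noncomputable def relMap : (D.S × D.E × ℕ →₀ ℤ) →ₗ[ℤ] D.F :=
  Finsupp.linearCombination ℤ fun p => D.w p.1 p.2.1 p.2.2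

theorem relMap_single (p : D.S × D.E × ℕ) (k : ℤ) :
    D.relMap (Finsupp.single p k) = k • D.w p.1 p.2.1 p.2.2 :=
  Finsupp.linearCombination_single ..

theorem coe_range_relMap : range D.relMap = (D.K : Set D.F) := by
  have hrelators : {k | ∃ (δ : D.S) (ν : D.E) (n : ℕ), k = D.w δ ν n} =
      range fun p : D.S × D.E × ℕ => D.w p.1 p.2.1 p.2.2 := by
    ext k
    simp [eq_comm]
  rw [K, hrelators, ← Submodule.span_int_eq_addSubgroupClosure, Submodule.coe_toAddSubgroup,
    ← Finsupp.range_linearCombination, LinearMap.coe_range, relMap]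

theorem w_apply_y (δ δ' : D.S) (ν ν' : D.E) (n m : ℕ) :
    D.w δ' ν' m (.y δ ν n) =
      2 * Finsupp.single (δ', ν', m + 1) (1 : ℤ) (δ, ν, n) -
        Finsupp.single (δ', ν', m) (1 : ℤ) (δ, ν, n) := by
  classical
  unfold w
  split_ifs <;> simp [Finsupp.single_apply]

theorem relMap_apply_y_zero (c : D.S × D.E × ℕ →₀ ℤ) (δ : D.S) (ν : D.E) :
    D.relMap c (.y δ ν 0) = -c (δ, ν, 0) := by
  classical
  induction c using Finsupp.induction_linear with
  | zero => simp
  | add f g hf hg =>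
    rw [map_add, Finsupp.add_apply, hf, hg, Finsupp.add_apply]
    ring
  | single p k => simp [relMap_single, w_apply_y, Finsupp.single_apply]

theorem relMap_apply_y_succ (c : D.S × D.E × ℕ →₀ ℤ) (δ : D.S) (ν : D.E) (n : ℕ) :
    D.relMap c (.y δ ν (n + 1)) = 2 * c (δ, ν, n) - c (δ, ν, n + 1) := by
  classical
  induction c using Finsupp.induction_linear with
  | zero => simp
  | add f g hf hg =>
    simp only [map_add, Finsupp.add_apply, hf, hg]
    ring
  | single p k =>
    simp only [relMap_single, Finsupp.smul_apply, w_apply_y, Finsupp.single_apply, Prod.ext_iff,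
      add_left_inj]
    split_ifs <;> simp <;> ring

theorem relMap_injective : Function.Injective D.relMap := by
  rw [injective_iff_map_eq_zero]
  intro c hc
  ext ⟨δ, ν, n⟩
  induction n with
  | zero => simpa [hc] using (D.relMap_apply_y_zero c δ ν).symm
  | succ n ih => simpa [hc, ih] using (D.relMap_apply_y_succ c δ ν n).symm

theorem exists_isSolution {H A : Type u} [AddCommGroup H] [AddCommGroup A] (hH : D.IsBuilt H)
    (hExt : Subsingleton (ExtGroup H A)) (a : D.S → D.E → ℕ → A) :
    ∃ (x : Iio (Order.succ μ).ord → A) (z : D.S → Iio μ.ord.cof.ord → A)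
      (y : D.S → D.E → ℕ → A), ∀ δ, D.IsSolution (fun i => x (D.eta δ i)) (z δ) (y δ) (a δ) := by
  classical
  obtain ⟨e⟩ := hH
  let p : D.F →+ H := e.symm.toAddMonoidHom.comp (QuotientAddGroup.mk' D.K)
  have hexact : Function.Exact D.relMap p.toIntLinearMap := fun k => by
    rw [D.coe_range_relMap]
    change e.symm (QuotientAddGroup.mk k) = 0 ↔ _
    rw [map_eq_zero_iff _ e.symm.injective, QuotientAddGroup.eq_zero_iff]
    rfl
  obtain ⟨ψ, hψ⟩ := exists_extend_of_subsingleton_ext_of_small hExt D.relMap p.toIntLinearMap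
    D.relMap_injective hexact (e.symm.surjective.comp (QuotientAddGroup.mk'_surjective _))
    (Finsupp.linearCombination ℤ fun q => a q.1 q.2.1 q.2.2)
  refine ⟨fun β => ψ (D.gen (.x β)),
    fun δ j => if hσ : ℵ₀ < μ.ord.cof then ψ (D.gen (.z hσ δ j)) else 0,
    fun δ ν n => ψ (D.gen (.y δ ν n)), fun δ ν n => ?_⟩
  have hψw : ψ (D.w δ ν n) = a δ ν n := by
    simpa [relMap_single] using LinearMap.congr_fun hψ (Finsupp.single (δ, ν, n) 1)
  rw [← hψw, w, map_add, map_sub, map_sub, map_zsmul]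
  split_ifs <;> simp [eta, addNat, etaAdd]

section Unsolvable

variable {A : Type u} [AddCommGroup A] {X : Iio μ.ord.cof.ord → Set A}

theorem exists_not_isSolution_of_aleph0_lt_cof (hA : IsWhitehead A) (hμ : μ.IsStrongLimit)
    (hunc : ℵ₀ < μ) (hcard : #A = μ) (hσ : ℵ₀ < μ.ord.cof) (hX : ∀ i, #(X i) < μ) :
    ∃ a : D.E → ℕ → A, ∀ x z y, (∀ i, x i ∈ X i) → ¬ D.IsSolution x z y a := by
  obtain ⟨r, hr⟩ := exists_rank_mk_lt D.aleph0_le (T := A) (Cardinal.lift_le.2 hcard.le)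
  let Y (ν : D.E) : AddSubgroup A :=
    AddSubgroup.closure ({b | r b ≤ ν.1} ∪ ⋃ n, X (D.addNat ν.1 n))
  have hY (ν : D.E) : #(Y ν) < μ := mk_closure_lt hunc <|
    mk_union_lt hunc.le (Cardinal.lift_lt.1 (hr ν.1)) <|
      mk_iUnion_lt hunc.le (by simpa) fun _ => hX _
  choose a ha using fun ν => hA.exists_not_towerSolvable one_lt_two hμ hunc hcard.ge (hY ν)
  refine ⟨a, fun x z y hx h => ?_⟩
  obtain ⟨ν, hνE, hν⟩ := exists_mem_forall_lt_of_isStationary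
    (isRegular_cof (isSuccLimit_ord D.aleph0_le)) hσ (D.E_stationary hσ) fun j => r (z j)
  refine ha ⟨ν, hνE⟩ ⟨y ⟨ν, hνE⟩, fun n => x (D.addNat ν n) - z (D.zetaNat hσ ⟨ν, hνE⟩ n),
    fun n => sub_mem ?_ ?_, fun n => ?_⟩
  · exact AddSubgroup.subset_closure (.inr (mem_iUnion.2 ⟨n, hx _⟩))
  · exact AddSubgroup.subset_closure (.inl (hν _ (D.zetaNat_lt hσ ⟨ν, hνE⟩ n)).le)
  · rw [← h ⟨ν, hνE⟩ n, dif_pos hσ]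
    module

theorem exists_not_isSolution_of_cof_eq_aleph0 (hA : IsWhitehead A) (hμ : μ.IsStrongLimit)
    (hunc : ℵ₀ < μ) (hcard : #A = μ) (hσ : μ.ord.cof = ℵ₀) (hX : ∀ i, #(X i) < μ) :
    ∃ a : D.E → ℕ → A, ∀ x z y, (∀ i, x i ∈ X i) → ¬ D.IsSolution x z y a := by
  obtain ⟨r, hr⟩ := exists_rank_mk_lt D.aleph0_le (T := A) (Cardinal.lift_le.2 hcard.le)
  have hord : μ.ord.cof.ord = ω := by rw [hσ, ord_aleph0]
  let ν : D.E := ⟨⟨0, hord.symm ▸ omega0_pos⟩, (D.E_countable hσ _).2 rfl⟩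
  have hrank (b : A) : ∃ n, r b ≤ D.addNat ν.1 n := by
    obtain ⟨n, hn⟩ := lt_omega0.1 ((r b).2.trans_eq hord)
    exact ⟨n, (hn.trans (_root_.zero_add _).symm).le⟩
  obtain ⟨a, ha⟩ := hA.exists_not_towerSolvable_of_forall_exists_mem one_lt_two hμ hunc hcard.ge
    hrank (fun n => Cardinal.lift_lt.1 (hr _)) fun n => hX (D.addNat ν.1 n)
  refine ⟨fun _ => a, fun x z y hx h => ha ⟨y ν, _, fun n => hx _, fun n => ?_⟩⟩
  rw [← show _ = a n from h ν n, dif_neg hσ.not_gt]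
  module

theorem exists_not_isSolution (hA : IsWhitehead A) (hμ : μ.IsStrongLimit)
    (hunc : ℵ₀ < μ) (hcard : #A = μ) (hX : ∀ i, #(X i) < μ) :
    ∃ a : D.E → ℕ → A, ∀ x z y, (∀ i, x i ∈ X i) → ¬ D.IsSolution x z y a := by
  rcases (aleph0_le_cof_ord D.aleph0_le).lt_or_eq with hσ | hσ
  · exact D.exists_not_isSolution_of_aleph0_lt_cof hA hμ hunc hcard hσ hX
  · exact D.exists_not_isSolution_of_cof_eq_aleph0 hA hμ hunc hcard hσ.symm hX

end Unsolvable

end LadderData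

theorem mainTheorem6_general (μ : Cardinal.{u}) (hμ : μ.IsSingular) (hlim : μ.IsStrongLimit)
    (hμ2 : (2 : Cardinal.{u}) ^ μ = Order.succ μ) (D : LadderData μ)
    (H : Type u) [AddCommGroup H] (hH : D.IsBuilt H)
    (A : Type u) [AddCommGroup A] (hAcard : #A = μ) (hA : IsWhitehead A) :
    Nontrivial (ExtGroup H A) := by
  have hunc : ℵ₀ < μ := (aleph0_le_cof_ord D.aleph0_le).trans_lt hμ.cof_ord_lt
  rw [← not_subsingleton_iff_nontrivial]
  intro hExt
  have hguesses : #(Iio μ.ord.cof.ord → Iio μ.ord.cof.ord) ≤ Cardinal.lift.{u + 1} μ := by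
    rw [mk_Iio_ord_fun, Cardinal.lift_le]
    exact (power_lt_of_isStrongLimit hlim hμ.cof_ord_lt hμ.cof_ord_lt).le
  obtain ⟨X, hX, hguess⟩ := exists_forall_mem_of_isStationary D.aleph0_le hμ2 D.S_stationary
    hguesses D.eta_lt hAcard.le
  choose a ha using fun g δ => D.exists_not_isSolution hA hlim hunc hAcard (hX g δ)
  choose x z y hsol using fun g => D.exists_isSolution hH hExt (a g)
  obtain ⟨g, δ, hx⟩ := hguess x
  exact ha g δ _ (z g δ) (y g δ) hx (hsol g δ)

theorem mainTheorem6 (hGCH : GCH.{u}) (μ : Cardinal.{u}) (hμ : μ.IsSingular) (D : LadderData μ)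
    (H : Type u) [AddCommGroup H] (hHcard : #H = Order.succ μ) (hH : D.IsBuilt H)
    (A : Type u) [AddCommGroup A] (hAcard : #A = μ) (hA : IsWhitehead A) :
    Nontrivial (ExtGroup H A) :=
  mainTheorem6_general μ hμ (hGCH.isStrongLimit hμ) (hGCH μ D.aleph0_le) D H hH A hAcard hA
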